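/- Let $A$ be a finite alphabet and let $L \subseteq A^*$. Then the following statements are equivalent: 1. $L$ is recognized by a finite aperiodic semigroup, i.e. there are a finite semigroup $S$ such that for every $x \in S$ there is $n \geq 1$ with $x^{n+1} = x^n$, a semigroup homomorphism $\varphi : A^* \to S$, and a subset $P \subseteq S$ with $L = \varphi^{-1}(P)$. 2. $L \in \mathrm{SD}(A^*)$, where $\mathrm{SD}(A^*)$ is the smallest class of languages over $A$ such that $\emptyset \in \mathrm{SD}(A^*)$ and $\{a\} \in \mathrm{SD}(A^*)$ for every $a \in A$; if $K, K' \in \mathrm{SD}(A^*)$, then $K \cup K' \in \mathrm{SD}(A^*)$ and $K K' \in \mathrm{SD}(A^*)$; and if $K \in \mathrm{SD}(A^*)$ is a prefix code with bounded synchronization delay, then $K^* \in \mathrm{SD}(A^*)$. Here a language $K \subseteq A^*$ is a prefix code if it does not contain the empty word and $u, uv \in K$ implies $u = uv$; a prefix code $K$ has bounded synchronization delay if there is $d \in \mathbb{N}$ such that for all $u, v, w \in A^*$, if $uvw \in K^*$ and $v \in K^d$, then $uv \in K^*$. 3. $L$ is star-free, i.e. $L$ can be built from the finite languages over $A$ by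 using concatenation and the Boolean operations (union, intersection, and complement in $A^*$). -/

import Mathlib

open scoped Computability

universe u v

/-- `semigroupPow x n` is the positive power `x ^ (n + 1)` in a semigroup
(which need not have a neutral element). -/
def semigroupPow {S : Type v} [Semigroup S] (x : S) : ℕ → S
  | 0 => x
  | n + 1 => semigroupPow x n * x

/-- A (finite) semigroup is aperiodic if every element `x` satisfies `x ^ (n + 1) = x ^ n`
for some `n ≥ 1`. -/
def IsAperiodicSemigroup (S : Type v) [Semigroup S] : Prop :=
  ∀ x : S, ∃ n : ℕ, semigroupPow x (n + 1) = semigroupPow x n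

/-- The semigroup `S` recognizes `L ⊆ A*` if there are a semigroup homomorphism `φ : A* → S`
and a subset `P ⊆ S` with `L = φ⁻¹(P)`. -/
def SemigroupRecognizes {A : Type u} (S : Type v) [Semigroup S] (L : Language A) : Prop :=
  ∃ (φ : FreeMonoid A →ₙ* S) (P : Set S), ∀ w : List A, w ∈ L ↔ φ (FreeMonoid.ofList w) ∈ P

/-- `L` is recognized by some finite aperiodic semigroup (in the universe `v`). -/
def IsRecognizedByFiniteAperiodicSemigroup {A : Type u} (L : Language A) : Prop :=
  ∃ (S : Type v) (_ : Semigroup S), Finite S ∧ IsAperiodicSemigroup S ∧ SemigroupRecognizes S L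

/-- A prefix code is a set of nonempty words such that `u ∈ K` and `u v ∈ K` imply `u = u v`. -/
def IsPrefixCode {A : Type u} (K : Language A) : Prop :=
  [] ∉ K ∧ ∀ u v : List A, u ∈ K → u ++ v ∈ K → u = u ++ v

/-- `K` has synchronization delay `d`: `u v w ∈ K*` and `v ∈ K ^ d` imply `u v ∈ K*`. -/
def HasSynchronizationDelay {A : Type u} (K : Language A) (d : ℕ) : Prop :=
  ∀ u v w : List A, u ++ v ++ w ∈ K∗ → v ∈ K ^ d → u ++ v ∈ K∗

/-- `K` has bounded synchronization delay. -/
def HasBoundedSynchronizationDelay {A : Type u} (K : Language A) : Prop :=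
  ∃ d : ℕ, HasSynchronizationDelay K d

/-- Schützenberger's class `SD(A*)`; here `+` is union and `*` is concatenation of languages. -/
inductive IsSD {A : Type u} : Language A → Prop
  | empty : IsSD 0
  | letter (a : A) : IsSD {[a]}
  | union {K L : Language A} : IsSD K → IsSD L → IsSD (K + L)
  | concat {K L : Language A} : IsSD K → IsSD L → IsSD (K * L)
  | star {K : Language A} :
      IsSD K → IsPrefixCode K → HasBoundedSynchronizationDelay K → IsSD K∗

/-- Star-free languages: built from the finite languages by concatenation and the Boolean
operations union, intersection, and complement in `A*`. -/
inductive IsStarFree {A : Type u} : Language A → Prop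
  | finite (L : Language A) : Set.Finite {w : List A | w ∈ L} → IsStarFree L
  | concat {K L : Language A} : IsStarFree K → IsStarFree L → IsStarFree (K * L)
  | union {K L : Language A} : IsStarFree K → IsStarFree L → IsStarFree (K + L)
  | inter {K L : Language A} : IsStarFree K → IsStarFree L → IsStarFree (K ⊓ L)
  | compl {K : Language A} : IsStarFree K → IsStarFree Kᶜ

-- The cycle runs aperiodic ⇒ SD ⇒ star-free ⇒ aperiodic.
--
-- Aperiodic ⇒ SD is an induction on the size of a monoid `M` and, inside it, on the alphabet. For a
-- letter `c` of value ≠ 1, cut a word at its first and last `c`: it is `u c x y`, where `u`, `y`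
-- avoid `c` and `x` is a product of blocks `uᵢ c`. Reading each block as the single letter `f(uᵢ)`
-- of the alphabet `M` turns the value of `c x` into a product in the local divisor of `M` at `f c`,
-- which is again aperiodic and smaller (`LocalDivisor.card_lt`). Decoding blocks preserves SD
-- because `c` marks their ends (`IsSD.decode`), so `wordsWithValue_insert` is an SD expression.
--
-- For SD ⇒ star-free only the star matters. Stripping factors of `K` from a word outside `K∗` ends
-- at a nonempty remainder with no prefix in `K`. By bounded delay the last `d` factors certify this
-- in every left context, which gives a star-free complement (`IsPrefixCode.notMem_kstar_iff`).
--
-- For star-free ⇒ aperiodic, the Schützenberger product handles concatenation and keeps monoids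
-- finite and aperiodic.

universe w

/-! ### Prefix codes and the complement of their star -/

section PrefixCodes

variable {A : Type u} {K : Language A}

lemma IsPrefixCode.append_inj (hK : IsPrefixCode K) {p p' r r' : List A}
    (hp : p ∈ K) (hp' : p' ∈ K) (h : p ++ r = p' ++ r') : p = p' ∧ r = r' := by
  rcases List.append_eq_append_iff.1 h with ⟨s, rfl, rfl⟩ | ⟨s, rfl, rfl⟩
  · have hs := hK.2 p s hp hp'
    have : s = [] := by simpa using hs
    simp [this]
  · have hs := hK.2 p' s hp' hp
    have : s = [] := by simpa using hs
    simp [this]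

lemma IsPrefixCode.append_inj_pow (hK : IsPrefixCode K) (n : ℕ) {p p' r r' : List A}
    (hp : p ∈ K ^ n) (hp' : p' ∈ K ^ n) (h : p ++ r = p' ++ r') : p = p' ∧ r = r' := by
  induction n generalizing p p' with
  | zero =>
    rw [pow_zero, Language.mem_one] at hp hp'
    subst hp hp'
    exact ⟨rfl, h⟩
  | succ n ih =>
    rw [pow_succ', Language.mem_mul] at hp hp'
    obtain ⟨a, ha, b, hb, rfl⟩ := hp
    obtain ⟨a', ha', b', hb', rfl⟩ := hp'
    rw [List.append_assoc, List.append_assoc] at h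
    obtain ⟨rfl, h₁⟩ := hK.append_inj ha ha' h
    obtain ⟨rfl, h₂⟩ := ih hb hb' h₁
    exact ⟨rfl, h₂⟩

lemma Language.mem_kstar_iff_exists_pow {w : List A} : w ∈ K∗ ↔ ∃ n : ℕ, w ∈ K ^ n := by
  rw [Language.kstar_eq_iSup_pow, Language.mem_iSup]

lemma Language.exists_mem_mul_of_mem_kstar {w : List A} (hw : w ∈ K∗) (hne : w ≠ []) :
    ∃ a ∈ K, ∃ b ∈ K∗, a ++ b = w := by
  rw [← Language.one_add_self_mul_kstar_eq_kstar, Language.mem_add, Language.mem_one] at hw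
  exact Language.mem_mul.1 (hw.resolve_left hne)

lemma IsPrefixCode.mem_kstar_of_append (hK : IsPrefixCode K) {u v : List A} (hu : u ∈ K∗)
    (huv : u ++ v ∈ K∗) : v ∈ K∗ := by
  obtain ⟨n, hn⟩ := Language.mem_kstar_iff_exists_pow.1 hu
  induction n generalizing u with
  | zero =>
    rw [pow_zero, Language.mem_one] at hn
    simpa [hn] using huv
  | succ n ih =>
    rw [pow_succ', Language.mem_mul] at hn
    obtain ⟨a, ha, b, hb, rfl⟩ := hn
    have hne : a ++ b ++ v ≠ [] := by
      intro h
      simp only [List.append_eq_nil_iff] at h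
      exact hK.1 (h.1.1 ▸ ha)
    obtain ⟨a', ha', b', hb', h⟩ := Language.exists_mem_mul_of_mem_kstar huv hne
    rw [List.append_assoc] at h
    obtain ⟨rfl, rfl⟩ := hK.append_inj ha' ha h
    exact ih (Language.mem_kstar_iff_exists_pow.2 ⟨n, hb⟩) hb' hb

/-- Words that start with exactly `n` factors from `K`, and are longer than these factors. -/
def Language.stuckAfter (K : Language A) (n : ℕ) : Language A :=
  K ^ n * (1 : Language A)ᶜ ⊓ (K ^ (n + 1) * (0 : Language A)ᶜ)ᶜ

lemma Language.mem_compl_iff {K : Language A} {w : List A} : w ∈ Kᶜ ↔ w ∉ K := Iff.rfl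

lemma Language.mem_stuckAfter {n : ℕ} {w : List A} : w ∈ K.stuckAfter n ↔
    (∃ p ∈ K ^ n, ∃ r, r ≠ [] ∧ p ++ r = w) ∧ ¬ ∃ p ∈ K ^ (n + 1), ∃ r, p ++ r = w := by
  simp [Language.stuckAfter, Language.mem_inf, Language.mem_mul, Language.mem_compl_iff]

lemma IsPrefixCode.notMem_kstar_of_stuckAfter (hK : IsPrefixCode K) {n : ℕ} {w : List A}
    (hw : w ∈ K.stuckAfter n) : w ∉ K∗ := by
  intro h
  obtain ⟨⟨p, hp, r, hr, rfl⟩, hno⟩ := Language.mem_stuckAfter.1 hw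
  have hrs := hK.mem_kstar_of_append (Language.mem_kstar_iff_exists_pow.2 ⟨n, hp⟩) h
  obtain ⟨a, ha, b, -, rfl⟩ := Language.exists_mem_mul_of_mem_kstar hrs hr
  exact hno ⟨p ++ a, by rw [pow_succ]; exact Language.append_mem_mul hp ha, b, by simp⟩

/-- Strip factors of `K` greedily; this stops because `[] ∉ K` makes the word shorter each time. -/
lemma IsPrefixCode.exists_stuck (hK : IsPrefixCode K) (w : List A) (hw : w ∉ K∗) :
    ∃ n, ∃ p ∈ K ^ n, ∃ r, r ≠ [] ∧ p ++ r = w ∧ ¬ ∃ a ∈ K, ∃ b, a ++ b = r := by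
  induction h : w.length using Nat.strong_induction_on generalizing w with
  | _ m ih =>
    by_cases hr : ∃ a ∈ K, ∃ b, a ++ b = w
    · obtain ⟨a, ha, b, rfl⟩ := hr
      have ha0 : a ≠ [] := fun h => hK.1 (h ▸ ha)
      have hb : b ∉ K∗ := fun hb => hw <| by
        rw [← Language.one_add_self_mul_kstar_eq_kstar]
        exact Or.inr (Language.append_mem_mul ha hb)
      have hlt : b.length < m := by
        have := List.length_pos_of_ne_nil ha0
        rw [List.length_append] at h
        omega
      obtain ⟨n, p, hp, r, hr, rfl, hno⟩ := ih _ hlt b hb rfl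
      exact ⟨n + 1, a ++ p, by rw [pow_succ']; exact Language.append_mem_mul ha hp, r, hr,
        by simp, hno⟩
    · exact ⟨0, [], by simp, w, fun h0 => hw (h0 ▸ Language.nil_mem_kstar K), rfl, hr⟩

lemma IsPrefixCode.mem_stuckAfter (hK : IsPrefixCode K) {n : ℕ} {p r : List A} (hp : p ∈ K ^ n)
    (hr : r ≠ []) (hno : ¬ ∃ a ∈ K, ∃ b, a ++ b = r) : p ++ r ∈ K.stuckAfter n := by
  refine Language.mem_stuckAfter.2 ⟨⟨p, hp, r, hr, rfl⟩, ?_⟩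
  rintro ⟨q, hq, s, hs⟩
  rw [pow_succ, Language.mem_mul] at hq
  obtain ⟨q, hq, a, ha, rfl⟩ := hq
  rw [List.append_assoc] at hs
  exact hno ⟨a, ha, s, (hK.append_inj_pow n hq hp hs).2⟩

/-- The complement of `K∗` for a prefix code `K` with synchronization delay `d`. -/
lemma IsPrefixCode.notMem_kstar_iff (hK : IsPrefixCode K) {d : ℕ}
    (hd : HasSynchronizationDelay K d) (w : List A) :
    w ∉ K∗ ↔ (∃ i < d, w ∈ K.stuckAfter i) ∨ w ∈ (0 : Language A)ᶜ * K.stuckAfter d := by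
  constructor
  · intro hw
    obtain ⟨n, p, hp, r, hr, rfl, hno⟩ := hK.exists_stuck w hw
    -- Once there are at least `d` factors, only the last `d` are kept; the others go into the
    -- arbitrary left context.
    rcases lt_or_ge n d with hn | hn
    · exact Or.inl ⟨n, hn, hK.mem_stuckAfter hp hr hno⟩
    · obtain ⟨k, rfl⟩ := Nat.exists_eq_add_of_le' hn
      rw [pow_add, Language.mem_mul] at hp
      obtain ⟨p, -, q, hq, rfl⟩ := hp
      rw [List.append_assoc]
      exact Or.inr (Language.append_mem_mul (Language.notMem_zero p) (hK.mem_stuckAfter hq hr hno))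
  · rintro (⟨i, -, hi⟩ | h)
    · exact hK.notMem_kstar_of_stuckAfter hi
    · intro hw
      obtain ⟨u, -, x, hx, rfl⟩ := Language.mem_mul.1 h
      obtain ⟨⟨p, hp, r, hr, rfl⟩, hno⟩ := Language.mem_stuckAfter.1 hx
      rw [← List.append_assoc] at hw
      -- The delay makes `u ++ p` a word of `K∗`, so the remainder `r` also lies in `K∗` and starts
      -- with a factor from `K`.
      have hrs := hK.mem_kstar_of_append (hd u p r hw hp) hw
      obtain ⟨a, ha, b, -, rfl⟩ := Language.exists_mem_mul_of_mem_kstar hrs hr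
      exact hno ⟨p ++ a, by rw [pow_succ]; exact Language.append_mem_mul hp ha, b, by simp⟩

end PrefixCodes

/-! ### From SD to star-free -/

section StarFree

variable {A : Type u} {K : Language A}

lemma IsStarFree.of_mem_iff {L : Language A} (hK : IsStarFree K) (h : ∀ w, w ∈ L ↔ w ∈ K) :
    IsStarFree L :=
  Language.ext h ▸ hK

lemma isStarFree_zero : IsStarFree (0 : Language A) :=
  .finite _ (by simp [Language.notMem_zero])

lemma isStarFree_one : IsStarFree (1 : Language A) :=
  .finite _ (by simp [Language.mem_one])

lemma IsStarFree.pow (hK : IsStarFree K) (n : ℕ) : IsStarFree (K ^ n) := by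
  induction n with
  | zero => exact isStarFree_one
  | succ n ih => rw [pow_succ]; exact ih.concat hK

lemma IsStarFree.stuckAfter (hK : IsStarFree K) (n : ℕ) : IsStarFree (K.stuckAfter n) :=
  ((hK.pow n).concat isStarFree_one.compl).inter
    ((hK.pow (n + 1)).concat isStarFree_zero.compl).compl

lemma IsStarFree.exists_lt {K : ℕ → Language A} (hK : ∀ i, IsStarFree (K i)) (d : ℕ) :
    IsStarFree ({w | ∃ i < d, w ∈ K i} : Language A) := by
  induction d with
  | zero =>
    refine isStarFree_zero.of_mem_iff fun w => ?_
    exact ⟨fun ⟨i, hi, _⟩ => absurd hi (Nat.not_lt_zero i),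
      fun h => absurd h (Language.notMem_zero w)⟩
  | succ d ih =>
    refine (ih.union (hK d)).of_mem_iff fun w => ?_
    constructor
    · rintro ⟨i, hi, hw⟩
      rcases Nat.lt_succ_iff_lt_or_eq.1 hi with hi | rfl
      · exact Or.inl ⟨i, hi, hw⟩
      · exact Or.inr hw
    · rintro (⟨i, hi, hw⟩ | hw)
      · exact ⟨i, hi.trans (Nat.lt_succ_self d), hw⟩
      · exact ⟨d, Nat.lt_succ_self d, hw⟩

lemma IsStarFree.kstar (hK : IsStarFree K) (hp : IsPrefixCode K)
    (hb : HasBoundedSynchronizationDelay K) : IsStarFree K∗ := by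
  obtain ⟨d, hd⟩ := hb
  refine ((IsStarFree.exists_lt hK.stuckAfter d).union
    (isStarFree_zero.compl.concat (hK.stuckAfter d))).compl.of_mem_iff fun w => ?_
  rw [Language.mem_compl_iff, ← not_iff_not, not_not]
  exact hp.notMem_kstar_iff hd w

lemma IsSD.isStarFree (hK : IsSD K) : IsStarFree K := by
  induction hK with
  | empty => exact isStarFree_zero
  | letter a => exact .finite _ (Set.finite_singleton [a])
  | union _ _ h h' => exact h.union h'
  | concat _ _ h h' => exact h.concat h'
  | star _ hp hb h => exact h.kstar hp hb

end StarFree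

/-! ### From star-free to aperiodic: the Schützenberger product -/

section Aperiodic

/-- A monoid is aperiodic if every element `x` satisfies `x ^ (n + 1) = x ^ n` for some `n`. -/
def IsAperiodicMonoid (M : Type*) [Monoid M] : Prop :=
  ∀ x : M, ∃ n : ℕ, x ^ (n + 1) = x ^ n

lemma pow_eq_of_pow_succ_eq {M : Type*} [Monoid M] {x : M} {n m k : ℕ} (h : x ^ (n + 1) = x ^ n)
    (hm : n ≤ m) (hk : n ≤ k) : x ^ m = x ^ k := by
  have key : ∀ m, n ≤ m → x ^ m = x ^ n := by
    intro m hm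
    induction m, hm using Nat.le_induction with
    | base => rfl
    | succ m _ ih => rw [pow_succ, ih, ← pow_succ, h]
  rw [key m hm, key k hk]

/-- The product of triples `(x, y, X)` in which `X` collects pairs, acted upon by the first
components from the left and by the second components from the right. -/
@[ext]
structure SchutzenbergerProduct (M N : Type*) where
  fst : M
  snd : N
  pairs : Set (M × N)

namespace SchutzenbergerProduct

variable {M N : Type*} [Monoid M] [Monoid N]

instance : Mul (SchutzenbergerProduct M N) where
  mul s t := ⟨s.fst * t.fst, s.snd * t.snd,
    (fun p : M × N => (s.fst * p.1, p.2)) '' t.pairs ∪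
      (fun p : M × N => (p.1, p.2 * t.snd)) '' s.pairs⟩

instance : One (SchutzenbergerProduct M N) where
  one := ⟨1, 1, ∅⟩

@[simp] lemma one_fst : (1 : SchutzenbergerProduct M N).fst = 1 := rfl
@[simp] lemma one_snd : (1 : SchutzenbergerProduct M N).snd = 1 := rfl
@[simp] lemma one_pairs : (1 : SchutzenbergerProduct M N).pairs = ∅ := rfl
@[simp] lemma mul_fst (s t : SchutzenbergerProduct M N) : (s * t).fst = s.fst * t.fst := rfl
@[simp] lemma mul_snd (s t : SchutzenbergerProduct M N) : (s * t).snd = s.snd * t.snd := rfl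
lemma mul_pairs (s t : SchutzenbergerProduct M N) : (s * t).pairs =
    (fun p : M × N => (s.fst * p.1, p.2)) '' t.pairs ∪
      (fun p : M × N => (p.1, p.2 * t.snd)) '' s.pairs := rfl

instance : Monoid (SchutzenbergerProduct M N) where
  mul_assoc s t r := by
    refine SchutzenbergerProduct.ext (mul_assoc _ _ _) (mul_assoc _ _ _) ?_
    simp only [mul_pairs, mul_fst, mul_snd, Set.image_union, Set.image_image, Set.union_assoc,
      mul_assoc]
  one_mul s := SchutzenbergerProduct.ext (one_mul _) (one_mul _) (by simp [mul_pairs])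
  mul_one s := SchutzenbergerProduct.ext (mul_one _) (mul_one _) (by simp [mul_pairs])

instance [Finite M] [Finite N] : Finite (SchutzenbergerProduct M N) :=
  Finite.of_injective (fun s => (s.fst, s.snd, s.pairs)) fun s t h => by
    simp only [Prod.mk.injEq] at h
    exact SchutzenbergerProduct.ext h.1 h.2.1 h.2.2

lemma pow_fst (s : SchutzenbergerProduct M N) (n : ℕ) : (s ^ n).fst = s.fst ^ n := by
  induction n with
  | zero => simp
  | succ n ih => rw [pow_succ, pow_succ, mul_fst, ih]

lemma pow_snd (s : SchutzenbergerProduct M N) (n : ℕ) : (s ^ n).snd = s.snd ^ n := by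
  induction n with
  | zero => simp
  | succ n ih => rw [pow_succ, pow_succ, mul_snd, ih]

lemma mem_pow_pairs (s : SchutzenbergerProduct M N) (n : ℕ) (q : M × N) :
    q ∈ (s ^ n).pairs ↔
      ∃ i j, i + j + 1 = n ∧ ∃ p ∈ s.pairs, (s.fst ^ i * p.1, p.2 * s.snd ^ j) = q := by
  induction n generalizing q with
  | zero => simp
  | succ n ih =>
    rw [pow_succ, mul_pairs, pow_fst]
    constructor
    · rintro (⟨p, hp, rfl⟩ | ⟨p, hp, rfl⟩)
      · exact ⟨n, 0, rfl, p, hp, by simp⟩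
      · obtain ⟨i, j, rfl, p', hp', rfl⟩ := (ih p).1 hp
        exact ⟨i, j + 1, rfl, p', hp', by simp [pow_succ, mul_assoc]⟩
    · rintro ⟨i, j, hij, p, hp, rfl⟩
      rcases j with _ | j
      · obtain rfl : i = n := by omega
        exact Or.inl ⟨p, hp, by simp⟩
      · exact Or.inr ⟨_, (ih (s.fst ^ i * p.1, p.2 * s.snd ^ j)).2
          ⟨i, j, by omega, p, hp, rfl⟩, by simp [pow_succ, mul_assoc]⟩

/-- A pair in a power has the form `(xⁱ p, q yʲ)`. When `i + j ≥ m + n`, one of the two exponents is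
in its stable range, so it can absorb a change of the total by one. -/
lemma isAperiodicMonoid (hM : IsAperiodicMonoid M) (hN : IsAperiodicMonoid N) :
    IsAperiodicMonoid (SchutzenbergerProduct M N) := by
  intro s
  obtain ⟨m, hm⟩ := hM s.fst
  obtain ⟨n, hn⟩ := hN s.snd
  refine ⟨m + n + 1, SchutzenbergerProduct.ext ?_ ?_ ?_⟩
  · rw [pow_fst, pow_fst]
    exact pow_eq_of_pow_succ_eq hm (by omega) (by omega)
  · rw [pow_snd, pow_snd]
    exact pow_eq_of_pow_succ_eq hn (by omega) (by omega)
  · ext q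
    rw [mem_pow_pairs, mem_pow_pairs]
    constructor
    · rintro ⟨i, j, hij, p, hp, rfl⟩
      by_cases hi : m < i
      · refine ⟨i - 1, j, by omega, p, hp, ?_⟩
        rw [pow_eq_of_pow_succ_eq hm (m := i - 1) (k := i) (by omega) (by omega)]
      · refine ⟨i, j - 1, by omega, p, hp, ?_⟩
        rw [pow_eq_of_pow_succ_eq hn (m := j - 1) (k := j) (by omega) (by omega)]
    · rintro ⟨i, j, hij, p, hp, rfl⟩
      by_cases hi : m ≤ i
      · refine ⟨i + 1, j, by omega, p, hp, ?_⟩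
        rw [pow_eq_of_pow_succ_eq hm (m := i + 1) (k := i) (by omega) (by omega)]
      · refine ⟨i, j + 1, by omega, p, hp, ?_⟩
        rw [pow_eq_of_pow_succ_eq hn (m := j + 1) (k := j) (by omega) (by omega)]

variable {A : Type*} (f : A → M) (g : A → N)

/-- The value of a letter. -/
def ofLetter (a : A) : SchutzenbergerProduct M N := ⟨f a, g a, {(1, g a)}⟩

lemma prod_map_ofLetter_fst (w : List A) :
    (w.map (ofLetter f g)).prod.fst = (w.map f).prod := by
  induction w with
  | nil => rfl
  | cons a w ih => simp [ih, ofLetter]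

lemma prod_map_ofLetter_snd (w : List A) :
    (w.map (ofLetter f g)).prod.snd = (w.map g).prod := by
  induction w with
  | nil => rfl
  | cons a w ih => simp [ih, ofLetter]

/-- The pairs record every cut of the word except the one at its right end, which is missing since
the empty word must have no pairs. -/
lemma mem_prod_map_ofLetter_pairs (w : List A) (q : M × N) :
    q ∈ (w.map (ofLetter f g)).prod.pairs ↔
      ∃ u v, v ≠ [] ∧ u ++ v = w ∧ ((u.map f).prod, (v.map g).prod) = q := by
  induction w generalizing q with
  | nil => simp
  | cons a w ih =>
    rw [List.map_cons, List.prod_cons, mul_pairs, prod_map_ofLetter_snd]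
    constructor
    · rintro (⟨p, hp, rfl⟩ | ⟨p, hp, rfl⟩)
      · obtain ⟨u, v, hv, rfl, rfl⟩ := (ih p).1 hp
        exact ⟨a :: u, v, hv, rfl, by simp [ofLetter]⟩
      · obtain rfl : p = (1, g a) := hp
        exact ⟨[], a :: w, by simp, rfl, by simp⟩
    · rintro ⟨u, v, hv, h, rfl⟩
      rcases u with _ | ⟨b, u⟩
      · obtain rfl : v = a :: w := h
        exact Or.inr ⟨_, rfl, by simp⟩
      · obtain ⟨rfl, rfl⟩ := List.cons.inj h
        exact Or.inl ⟨_, (ih _).2 ⟨u, v, hv, rfl, rfl⟩, by simp [ofLetter]⟩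

end SchutzenbergerProduct

/-- `L` is recognized by a finite aperiodic monoid. -/
def IsRecognizedByFiniteAperiodicMonoid {A : Type u} (L : Language A) : Prop :=
  ∃ (M : Type) (_ : Monoid M), Finite M ∧ IsAperiodicMonoid M ∧
    ∃ (f : A → M) (P : Set M), ∀ w : List A, w ∈ L ↔ (w.map f).prod ∈ P

namespace IsRecognizedByFiniteAperiodicMonoid

variable {A : Type u} {K L : Language A}

lemma of_mem_iff (hK : IsRecognizedByFiniteAperiodicMonoid K) (h : ∀ w, w ∈ L ↔ w ∈ K) :
    IsRecognizedByFiniteAperiodicMonoid L :=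
  Language.ext h ▸ hK

lemma compl (hK : IsRecognizedByFiniteAperiodicMonoid K) :
    IsRecognizedByFiniteAperiodicMonoid Kᶜ := by
  obtain ⟨M, _, hfin, hap, f, P, h⟩ := hK
  exact ⟨M, _, hfin, hap, f, Pᶜ, fun w => not_congr (h w)⟩

lemma inter (hK : IsRecognizedByFiniteAperiodicMonoid K)
    (hL : IsRecognizedByFiniteAperiodicMonoid L) :
    IsRecognizedByFiniteAperiodicMonoid (K ⊓ L) := by
  obtain ⟨M, _, _, hM, f, P, hP⟩ := hK
  obtain ⟨N, _, _, hN, g, Q, hQ⟩ := hL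
  refine ⟨SchutzenbergerProduct M N, inferInstance, inferInstance,
    SchutzenbergerProduct.isAperiodicMonoid hM hN, SchutzenbergerProduct.ofLetter f g,
    {s | s.fst ∈ P ∧ s.snd ∈ Q}, fun w => ?_⟩
  rw [Language.mem_inf, hP, hQ, Set.mem_ofPred_eq, SchutzenbergerProduct.prod_map_ofLetter_fst,
    SchutzenbergerProduct.prod_map_ofLetter_snd]

lemma union (hK : IsRecognizedByFiniteAperiodicMonoid K)
    (hL : IsRecognizedByFiniteAperiodicMonoid L) :
    IsRecognizedByFiniteAperiodicMonoid (K + L) := by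
  refine ((hK.compl.inter hL.compl).compl).of_mem_iff fun w => ?_
  change _ ↔ ¬ (_ ∧ _)
  rw [Language.mem_add, not_and_or]
  exact or_congr not_not.symm not_not.symm

lemma concat (hK : IsRecognizedByFiniteAperiodicMonoid K)
    (hL : IsRecognizedByFiniteAperiodicMonoid L) :
    IsRecognizedByFiniteAperiodicMonoid (K * L) := by
  obtain ⟨M, _, _, hM, f, P, hP⟩ := hK
  obtain ⟨N, _, _, hN, g, Q, hQ⟩ := hL
  refine ⟨SchutzenbergerProduct M N, inferInstance, inferInstance,
    SchutzenbergerProduct.isAperiodicMonoid hM hN, SchutzenbergerProduct.ofLetter f g,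
    -- The first alternative supplies the cut with empty right part.
    {s | (s.fst ∈ P ∧ 1 ∈ Q) ∨ ∃ q ∈ s.pairs, q.1 ∈ P ∧ q.2 ∈ Q}, fun w => ?_⟩
  simp only [Set.mem_ofPred_eq, SchutzenbergerProduct.prod_map_ofLetter_fst,
    SchutzenbergerProduct.mem_prod_map_ofLetter_pairs, Language.mem_mul, hP, hQ]
  constructor
  · rintro ⟨u, hu, v, hv, rfl⟩
    by_cases h : v = []
    · subst h
      exact Or.inl ⟨by simpa using hu, by simpa using hv⟩
    · exact Or.inr ⟨_, ⟨u, v, h, rfl, rfl⟩, hu, hv⟩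
  · rintro (⟨h, h1⟩ | ⟨_, ⟨u, v, -, rfl, rfl⟩, hu, hv⟩)
    · exact ⟨w, h, [], by simpa using h1, by simp⟩
    · exact ⟨u, hu, v, hv, rfl⟩

lemma setOf_forall_mem (B : Set A) :
    IsRecognizedByFiniteAperiodicMonoid ({w | ∀ a ∈ w, a ∈ B} : Language A) := by
  classical
  -- `ZMod 2` serves as the multiplicative monoid `{0, 1}`, where a letter outside `B` sends the
  -- product to 0.
  refine ⟨ZMod 2, inferInstance, inferInstance, fun x => ⟨1, ?_⟩,
    fun a => if a ∈ B then 1 else 0, {1}, fun w => ?_⟩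
  · revert x; decide
  · change (∀ a ∈ w, a ∈ B) ↔ _
    induction w with
    | nil => simp
    | cons a w ih =>
      rw [List.forall_mem_cons, ih]
      by_cases h : a ∈ B <;> simp [h]

lemma one : IsRecognizedByFiniteAperiodicMonoid (1 : Language A) := by
  refine (setOf_forall_mem (∅ : Set A)).of_mem_iff fun w => ?_
  exact (Language.mem_one w).trans List.eq_nil_iff_forall_not_mem

/-- Length one means neither empty nor a product of two nonempty words. -/
lemma singleton_letter (a : A) : IsRecognizedByFiniteAperiodicMonoid ({[a]} : Language A) := by
  refine ((one.union (one.compl.concat one.compl)).compl.inter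
    (setOf_forall_mem {a})).of_mem_iff fun w => ?_
  change w = [a] ↔ ¬ (w = [] ∨ ∃ u, u ≠ [] ∧ ∃ v, v ≠ [] ∧ u ++ v = w) ∧ ∀ b ∈ w, b = a
  constructor
  · rintro rfl
    refine ⟨?_, by simp⟩
    rintro (h | ⟨u, hu, v, hv, h⟩)
    · simp at h
    · rcases List.append_eq_singleton_iff.1 h with h | h
      · exact hu h.1
      · exact hv h.2
  · rintro ⟨h, hb⟩
    rcases w with _ | ⟨b, _ | ⟨c, w⟩⟩
    · simp at h
    · simp [hb b]
    · exact absurd (Or.inr ⟨[b], by simp, c :: w, by simp, rfl⟩) h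

lemma singleton (w : List A) : IsRecognizedByFiniteAperiodicMonoid ({w} : Language A) := by
  induction w with
  | nil => exact one
  | cons a w ih =>
    convert (singleton_letter a).concat ih using 1
    exact (Set.image2_singleton (f := fun u v : List A => u ++ v) (a := [a]) (b := w)).symm

lemma of_finite {L : Set (List A)} (hL : L.Finite) :
    IsRecognizedByFiniteAperiodicMonoid (L : Language A) := by
  induction L, hL using Set.Finite.induction_on with
  | empty =>
    refine ((one.union one.compl).compl).of_mem_iff fun w => ?_
    change False ↔ ¬ (_ ∨ ¬ _)
    tauto
  | insert _ _ ih => exact (singleton _).union ih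

end IsRecognizedByFiniteAperiodicMonoid

lemma IsStarFree.isRecognizedByFiniteAperiodicMonoid {A : Type u} {L : Language A}
    (hL : IsStarFree L) : IsRecognizedByFiniteAperiodicMonoid L := by
  induction hL with
  | finite L h => exact .of_finite h
  | concat _ _ h h' => exact h.concat h'
  | union _ _ h h' => exact h.union h'
  | inter _ _ h h' => exact h.inter h'
  | compl _ h => exact h.compl

lemma semigroupPow_eq_pow {M : Type*} [Monoid M] (x : M) (n : ℕ) :
    semigroupPow x n = x ^ (n + 1) := by
  induction n with
  | zero => simp [semigroupPow]
  | succ n ih => rw [semigroupPow, ih, pow_succ x (n + 1)]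

lemma semigroupPow_map {S T : Type*} [Semigroup S] [Semigroup T] (f : S →ₙ* T) (x : S) (n : ℕ) :
    f (semigroupPow x n) = semigroupPow (f x) n := by
  induction n with
  | zero => rfl
  | succ n ih => rw [semigroupPow, map_mul, ih, semigroupPow]

lemma IsRecognizedByFiniteAperiodicMonoid.isRecognizedByFiniteAperiodicSemigroup {A : Type u}
    {L : Language A} (hL : IsRecognizedByFiniteAperiodicMonoid L) :
    IsRecognizedByFiniteAperiodicSemigroup.{u, v} L := by
  obtain ⟨M, _, _, hM, f, P, hP⟩ := hL
  refine ⟨ULift.{v} M, inferInstance, inferInstance, fun x => ?_,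
    (MulEquiv.ulift.symm.toMonoidHom.comp (FreeMonoid.lift f)).toMulHom,
    ULift.down ⁻¹' P, fun w => ?_⟩
  · obtain ⟨n, hn⟩ := hM x.down
    refine ⟨n, ?_⟩
    rw [semigroupPow_eq_pow, semigroupPow_eq_pow]
    apply ULift.down_injective
    change x.down ^ (n + 1 + 1) = x.down ^ (n + 1)
    exact pow_eq_of_pow_succ_eq hn (by omega) (by omega)
  · rw [hP w]
    change _ ↔ FreeMonoid.lift f (FreeMonoid.ofList w) ∈ P
    rw [FreeMonoid.lift_apply]
    rfl

end Aperiodic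

/-! ### Local divisors -/

/-- The local divisor of `M` at `c`, carried by `c M ∩ M c`, with `(x c) ∘ (c y) = x c y`. -/
def LocalDivisor {M : Type w} [Monoid M] (c : M) : Type w :=
  {x : M // (∃ a, x = c * a) ∧ ∃ b, x = b * c}

namespace LocalDivisor

variable {M : Type w} [Monoid M] {c : M}

/-- Some element `b` with `x = b c`. -/
noncomputable def left (x : LocalDivisor c) : M := x.2.2.choose

lemma left_mul (x : LocalDivisor c) : x.left * c = x.1 := x.2.2.choose_spec.symm

/-- The product does not depend on the chosen `left`: with `y = c a`, both sides equal `x a`. -/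
lemma left_mul_val {x : LocalDivisor c} {b : M} (hb : x.1 = b * c) (y : LocalDivisor c) :
    x.left * y.1 = b * y.1 := by
  obtain ⟨a, ha⟩ := y.2.1
  rw [ha, ← mul_assoc, left_mul, hb, mul_assoc]

noncomputable instance : Mul (LocalDivisor c) where
  mul x y := ⟨x.left * y.1, by
    obtain ⟨a, ha⟩ := y.2.1
    obtain ⟨a', ha'⟩ := x.2.1
    exact ⟨a' * a, by rw [ha, ← mul_assoc, left_mul, ha', mul_assoc]⟩,
    ⟨x.left * y.left, by rw [mul_assoc, left_mul]⟩⟩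

lemma mul_val (x y : LocalDivisor c) : (x * y).1 = x.left * y.1 := rfl

lemma mul_val_of_eq {x : LocalDivisor c} {b : M} (hb : x.1 = b * c) (y : LocalDivisor c) :
    (x * y).1 = b * y.1 := left_mul_val hb y

instance : One (LocalDivisor c) where
  one := ⟨c, ⟨1, (mul_one c).symm⟩, ⟨1, (one_mul c).symm⟩⟩

lemma one_val : (1 : LocalDivisor c).1 = c := rfl

noncomputable instance : Monoid (LocalDivisor c) where
  mul_assoc x y z := Subtype.ext <| by
    rw [mul_val_of_eq (b := x.left * y.left) (by rw [mul_val, mul_assoc, left_mul]), mul_val,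
      mul_val, mul_assoc]
  one_mul x := Subtype.ext <| by
    rw [mul_val_of_eq (b := 1) (one_mul c).symm, one_mul]
  mul_one x := Subtype.ext <| by rw [mul_val, one_val, left_mul]

lemma pow_val {x : LocalDivisor c} {b : M} (hb : x.1 = b * c) (n : ℕ) :
    (x ^ n).1 = b ^ n * c := by
  induction n with
  | zero => rw [pow_zero, pow_zero, one_mul, one_val]
  | succ n ih => rw [pow_succ', mul_val_of_eq hb, ih, pow_succ', mul_assoc]

lemma isAperiodicMonoid (hM : IsAperiodicMonoid M) : IsAperiodicMonoid (LocalDivisor c) := by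
  intro x
  obtain ⟨n, hn⟩ := hM x.left
  exact ⟨n, Subtype.ext <| by rw [pow_val x.left_mul.symm, pow_val x.left_mul.symm, hn]⟩

instance [Finite M] : Finite (LocalDivisor c) := Subtype.finite

/-- The unit of `M` is lost: if `1 = b c`, then `bⁿ cⁿ = 1`, and cancelling `cⁿ` in `cⁿ⁺¹ = cⁿ`
forces `c = 1`. -/
lemma card_lt [Finite M] (hM : IsAperiodicMonoid M) (hc : c ≠ 1) :
    Nat.card (LocalDivisor c) < Nat.card M := by
  refine Finite.card_subtype_lt (x := 1) ?_
  rintro ⟨-, b, hb⟩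
  obtain ⟨n, hn⟩ := hM c
  have h : b ^ n * c ^ n = 1 := by
    clear hn
    induction n with
    | zero => simp
    | succ n ih =>
      rw [pow_succ, pow_succ', mul_assoc, ← mul_assoc b, ← hb, one_mul, ih]
  apply hc
  calc c = b ^ n * c ^ n * c := by rw [h, one_mul]
    _ = b ^ n * c ^ n := by rw [mul_assoc, ← pow_succ, hn]
    _ = 1 := h

/-- The element `c t c`. -/
def sandwich (c t : M) : LocalDivisor c :=
  ⟨c * t * c, ⟨t * c, mul_assoc _ _ _⟩, ⟨c * t, rfl⟩⟩

end LocalDivisor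

/-! ### Coding blocks ending in `c` by letters of `M` -/

section Coding

variable {A : Type u} {M : Type w} [Monoid M] (f : A → M) (c : A) (B : Finset A)

/-- Relates `u₁ c u₂ c ⋯ uₖ c`, where the `uᵢ` are words over `B`, to the word of the values
of the `uᵢ`. -/
inductive IsCoded : List A → List M → Prop
  | nil : IsCoded [] []
  | cons {u w : List A} {l : List M} (hu : ∀ a ∈ u, a ∈ B) (h : IsCoded w l) :
      IsCoded (u ++ c :: w) ((u.map f).prod :: l)

/-- The words whose code lies in `K`. -/
def decode (K : Language M) : Language A := {w | ∃ l ∈ K, IsCoded f c B w l}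

variable {f c B}

lemma mem_decode {K : Language M} {w : List A} :
    w ∈ decode f c B K ↔ ∃ l ∈ K, IsCoded f c B w l := Iff.rfl

lemma append_cons_inj_of_notMem {u u' w w' : List A} (hu : c ∉ u) (hu' : c ∉ u')
    (h : u ++ c :: w = u' ++ c :: w') : u = u' ∧ w = w' := by
  induction u generalizing u' with
  | nil =>
    rcases u' with _ | ⟨b, u'⟩
    · simpa using h
    · simp at h; simp [h.1] at hu'
  | cons a u ih =>
    rcases u' with _ | ⟨b, u'⟩
    · simp at h; simp [h.1] at hu
    · simp only [List.cons_append, List.cons.injEq] at h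
      obtain ⟨rfl, h⟩ := h
      obtain ⟨rfl, rfl⟩ := ih (fun h => hu (by simp [h])) (fun h => hu' (by simp [h])) h
      exact ⟨rfl, rfl⟩

namespace IsCoded

variable {u v z : List A} {l l' k : List M}

lemma append (hu : IsCoded f c B u l) (hv : IsCoded f c B v l') :
    IsCoded f c B (u ++ v) (l ++ l') := by
  induction hu with
  | nil => exact hv
  | cons hB _ ih =>
    rw [List.append_assoc, List.cons_append, List.cons_append]
    exact .cons hB ih

lemma split (h : IsCoded f c B z (l ++ l')) :
    ∃ u v, u ++ v = z ∧ IsCoded f c B u l ∧ IsCoded f c B v l' := by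
  induction l generalizing z with
  | nil => exact ⟨[], z, rfl, .nil, h⟩
  | cons m l ih =>
    rw [List.cons_append] at h
    cases h with
    | cons hB h =>
      obtain ⟨u, v, rfl, hu, hv⟩ := ih h
      exact ⟨_, v, by rw [List.append_assoc, List.cons_append], .cons hB hu, hv⟩

lemma tail (hc : c ∉ B) {x w : List A} (hx : ∀ a ∈ x, a ∈ B)
    (h : IsCoded f c B (x ++ c :: w) k) :
    ∃ k', k = (x.map f).prod :: k' ∧ IsCoded f c B w k' := by
  generalize hz : x ++ c :: w = z at h
  cases h with
  | nil => simp at hz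
  | cons hB h =>
    obtain ⟨rfl, rfl⟩ := append_cons_inj_of_notMem (fun h => hc (hx _ h)) (fun h => hc (hB _ h)) hz
    exact ⟨_, rfl, h⟩

lemma cancel (hc : c ∉ B) (hu : IsCoded f c B u l) (huv : IsCoded f c B (u ++ v) k) :
    ∃ l', k = l ++ l' ∧ IsCoded f c B v l' := by
  induction hu generalizing k with
  | nil => exact ⟨k, rfl, huv⟩
  | cons hB _ ih =>
    rw [List.append_assoc, List.cons_append] at huv
    obtain ⟨k, rfl, hwv⟩ := huv.tail hc hB
    obtain ⟨l', rfl, hv⟩ := ih hwv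
    exact ⟨l', rfl, hv⟩

lemma eq_nil_of_nil (h : IsCoded f c B u []) : u = [] := by cases h; rfl

lemma eq_nil (h : IsCoded f c B [] l) : l = [] := by
  generalize hz : ([] : List A) = z at h
  cases h with
  | nil => rfl
  | cons => simp at hz

lemma exists_eq_concat (h : IsCoded f c B u l) (hl : l ≠ []) : ∃ u', u = u' ++ [c] := by
  induction h with
  | nil => exact absurd rfl hl
  | @cons x w l hB h ih =>
    rcases l with _ | ⟨m, l⟩
    · exact ⟨x, by rw [h.eq_nil_of_nil]⟩
    · obtain ⟨u', rfl⟩ := ih (by simp)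
      exact ⟨x ++ c :: u', by simp⟩

/-- Cutting a coded word just after any `c` leaves a coded prefix; this is what resynchronizes
blocks. -/
lemma exists_prefix (h : IsCoded f c B (u ++ c :: v) k) : ∃ k', IsCoded f c B (u ++ [c]) k' := by
  generalize hz : u ++ c :: v = z at h
  induction h generalizing u with
  | nil => simp at hz
  | @cons x w l hB h ih =>
    rcases List.append_eq_append_iff.1 hz with ⟨s, rfl, hs⟩ | ⟨s, rfl, hs⟩
    · rcases s with _ | ⟨b, s⟩
      · exact ⟨_, by simpa using IsCoded.cons (f := f) (c := c) hB .nil⟩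
      · obtain ⟨rfl, -⟩ := List.cons.inj hs
        exact ⟨_, .cons (fun a ha => hB a (by simp [ha])) .nil⟩
    · rcases s with _ | ⟨b, s⟩
      · exact ⟨_, by simpa using IsCoded.cons (f := f) (c := c) hB .nil⟩
      · obtain ⟨rfl, hw⟩ := List.cons.inj hs
        obtain ⟨k', hk'⟩ := ih hw.symm
        exact ⟨_, by simpa using IsCoded.cons hB hk'⟩

lemma forall_mem (h : IsCoded f c B u l) : ∀ a ∈ u, a = c ∨ a ∈ B := by
  induction h with
  | nil => simp
  | cons hB _ ih =>
    simp only [List.mem_append, List.mem_cons]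
    rintro a (ha | rfl | ha)
    · exact Or.inr (hB a ha)
    · exact Or.inl rfl
    · exact ih a ha

/-- Adjacent sandwiches share a `c`: `(c s c) ∘ (c t c) = c s c t c`. The leading `f c` is the one
that no block supplies. -/
lemma mul_prod (h : IsCoded f c B u l) :
    f c * (u.map f).prod = (l.map (LocalDivisor.sandwich (f c))).prod.1 := by
  induction h with
  | nil => simp [LocalDivisor.one_val]
  | cons hB _ ih =>
    rw [List.map_cons, List.prod_cons, LocalDivisor.mul_val_of_eq (b := _ * _) rfl, ← ih]
    simp [mul_assoc]

end IsCoded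

lemma exists_isCoded_append [DecidableEq A] (r : List A) (hr : ∀ a ∈ r, a ∈ insert c B) :
    ∃ x y l, x ++ y = r ∧ IsCoded f c B x l ∧ ∀ a ∈ y, a ∈ B := by
  induction r with
  | nil => exact ⟨[], [], [], rfl, .nil, by simp⟩
  | cons a r ih =>
    obtain ⟨x, y, l, rfl, hx, hy⟩ := ih fun b hb => hr b (by simp [hb])
    rcases Finset.mem_insert.1 (hr a (by simp)) with rfl | ha
    · exact ⟨a :: x, y, _, rfl, .cons (u := []) (by simp) hx, hy⟩
    · cases hx with
      | nil => exact ⟨[], a :: y, [], rfl, .nil, by simpa using ⟨ha, hy⟩⟩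
      | @cons x w l hB h =>
        exact ⟨(a :: x) ++ c :: w, y, _, rfl, .cons (by simpa using ⟨ha, hB⟩) h, hy⟩

lemma decode_zero : decode f c B 0 = 0 := by
  ext w
  simp [mem_decode, Language.notMem_zero]

lemma decode_one : decode f c B 1 = 1 := by
  ext w
  simp only [mem_decode, Language.mem_one, exists_eq_left]
  exact ⟨IsCoded.eq_nil_of_nil, fun h => h ▸ .nil⟩

lemma decode_add (K L : Language M) :
    decode f c B (K + L) = decode f c B K + decode f c B L := by
  ext w
  simp only [mem_decode, Language.mem_add, or_and_right, exists_or]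

lemma decode_mul (K L : Language M) :
    decode f c B (K * L) = decode f c B K * decode f c B L := by
  ext w
  simp only [mem_decode, Language.mem_mul]
  constructor
  · rintro ⟨_, ⟨k, hk, l, hl, rfl⟩, h⟩
    obtain ⟨u, v, rfl, hu, hv⟩ := h.split
    exact ⟨u, ⟨k, hk, hu⟩, v, ⟨l, hl, hv⟩, rfl⟩
  · rintro ⟨u, ⟨k, hk, hu⟩, v, ⟨l, hl, hv⟩, rfl⟩
    exact ⟨_, ⟨k, hk, l, hl, rfl⟩, hu.append hv⟩

lemma decode_pow (K : Language M) (n : ℕ) : decode f c B (K ^ n) = decode f c B K ^ n := by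
  induction n with
  | zero => rw [pow_zero, pow_zero, decode_one]
  | succ n ih => rw [pow_succ, pow_succ, decode_mul, ih]

lemma decode_kstar (K : Language M) : decode f c B K∗ = (decode f c B K)∗ := by
  ext w
  simp only [Language.kstar_eq_iSup_pow, mem_decode, Language.mem_iSup, ← decode_pow]
  exact ⟨fun ⟨l, ⟨n, hn⟩, h⟩ => ⟨n, l, hn, h⟩, fun ⟨n, l, hn, h⟩ => ⟨l, ⟨n, hn⟩, h⟩⟩

lemma IsPrefixCode.decode (hc : c ∉ B) {K : Language M} (hK : IsPrefixCode K) :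
    IsPrefixCode (decode f c B K) := by
  constructor
  · rintro ⟨l, hl, h⟩
    exact hK.1 (h.eq_nil ▸ hl)
  · rintro u v ⟨l, hl, hu⟩ ⟨k, hk, huv⟩
    obtain ⟨l', rfl, hv⟩ := hu.cancel hc huv
    have := hK.2 l l' hl hk
    obtain rfl : l' = [] := by simpa using this
    rw [hv.eq_nil_of_nil, List.append_nil]

/-- The extra factor ends in `c`, so it brings the position to a block boundary; the remaining `d`
factors then synchronize the code words. -/
lemma HasSynchronizationDelay.decode (hc : c ∉ B) {K : Language M} (hK : IsPrefixCode K) {d : ℕ}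
    (hd : HasSynchronizationDelay K d) : HasSynchronizationDelay (decode f c B K) (d + 1) := by
  intro u v z huvz hv
  rw [← decode_kstar] at huvz ⊢
  obtain ⟨k, hk, huvz⟩ := huvz
  rw [pow_succ', Language.mem_mul] at hv
  obtain ⟨v₁, ⟨l₁, hl₁, hv₁⟩, v₂, hv₂, rfl⟩ := hv
  rw [← decode_pow] at hv₂
  obtain ⟨l₂, hl₂, hv₂⟩ := hv₂
  obtain ⟨v₁, rfl⟩ := hv₁.exists_eq_concat fun h => hK.1 (h ▸ hl₁)
  obtain ⟨k₁, hk₁⟩ : ∃ k₁, IsCoded f c B (u ++ v₁ ++ [c]) k₁ :=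
    IsCoded.exists_prefix (v := v₂ ++ z) (by simpa using huvz)
  have h₂ := hk₁.append hv₂
  obtain ⟨k₃, rfl, -⟩ := h₂.cancel hc (v := z) (by simpa using huvz)
  exact ⟨k₁ ++ l₂, hd k₁ l₂ k₃ hk hl₂, by simpa using h₂⟩

end Coding

/-! ### From aperiodic to SD -/

section SD

variable {A : Type u}

lemma IsSD.of_mem_iff {K L : Language A} (hK : IsSD K) (h : ∀ w, w ∈ L ↔ w ∈ K) : IsSD L :=
  Language.ext h ▸ hK

lemma IsSD.iSup {ι : Type*} [Finite ι] {K : ι → Language A} (hK : ∀ i, IsSD (K i)) :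
    IsSD (⨆ i, K i) := by
  have key : ∀ s : Set ι, s.Finite → IsSD (⨆ i ∈ s, K i) := by
    intro s hs
    induction s, hs using Set.Finite.induction_on with
    | empty =>
      refine IsSD.empty.of_mem_iff fun w => ?_
      simp only [Language.mem_iSup, Set.mem_empty_iff_false, IsEmpty.exists_iff,
        Language.notMem_zero, exists_false]
    | @insert i s _ _ ih =>
      refine ((hK i).union ih).of_mem_iff fun w => ?_
      simp only [Language.mem_iSup, Language.mem_add, Set.mem_insert_iff, exists_prop,
        or_and_right, exists_or, exists_eq_left]
  exact (key Set.univ Set.finite_univ).of_mem_iff fun w => by simp [Language.mem_iSup]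

/-- The words with value `m`. -/
def wordsOfValue {M : Type w} [Monoid M] (f : A → M) (m : M) : Language A :=
  {w | (w.map f).prod = m}

lemma mem_wordsOfValue {M : Type w} [Monoid M] {f : A → M} {m : M} {w : List A} :
    w ∈ wordsOfValue f m ↔ (w.map f).prod = m := Iff.rfl

/-- The words over `B` with value `m`. -/
def wordsWithValue {M : Type w} [Monoid M] (f : A → M) (B : Finset A) (m : M) : Language A :=
  {w | (∀ a ∈ w, a ∈ B) ∧ (w.map f).prod = m}

lemma mem_wordsWithValue {M : Type w} [Monoid M] {f : A → M} {B : Finset A} {m : M} {w : List A} :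
    w ∈ wordsWithValue f B m ↔ (∀ a ∈ w, a ∈ B) ∧ (w.map f).prod = m := Iff.rfl

/-- The words over `B`. -/
def wordsOver (B : Finset A) : Language A := {w | ∀ a ∈ w, a ∈ B}

lemma mem_wordsOver {B : Finset A} {w : List A} : w ∈ wordsOver B ↔ ∀ a ∈ w, a ∈ B := Iff.rfl

/-- This is the star of the one-letter words over `B`, with delay 0 since prefixes of words over `B`
are words over `B`. -/
lemma isSD_wordsOver (B : Finset A) : IsSD (wordsOver B) := by
  have hB : IsSD (⨆ a : B, ({[a.1]} : Language A)) := IsSD.iSup fun a => .letter a.1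
  have hmem : ∀ w, w ∈ (⨆ a : B, ({[a.1]} : Language A)) ↔ ∃ a ∈ B, w = [a] := fun w => by
    rw [Language.mem_iSup]
    change (∃ a : B, w = [a.1]) ↔ _
    simp
  have hstar : (⨆ a : B, ({[a.1]} : Language A))∗ = wordsOver B := by
    ext w
    rw [Language.mem_kstar, mem_wordsOver]
    constructor
    · rintro ⟨L, rfl, hL⟩ a ha
      obtain ⟨y, hy, hay⟩ := List.mem_flatten.1 ha
      obtain ⟨b, hb, rfl⟩ := (hmem y).1 (hL y hy)
      simpa [List.mem_singleton.1 hay] using hb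
    · intro hw
      refine ⟨w.map fun a => [a], (List.flatMap_singleton' w).symm, fun y hy => ?_⟩
      obtain ⟨a, ha, rfl⟩ := List.mem_map.1 hy
      exact (hmem _).2 ⟨a, hw a ha, rfl⟩
  rw [← hstar]
  refine hB.star ⟨fun h => by simpa using (hmem _).1 h, fun u v hu huv => ?_⟩
    ⟨0, fun u v w h _ => ?_⟩
  · obtain ⟨a, -, rfl⟩ := (hmem _).1 hu
    obtain ⟨b, -, h⟩ := (hmem _).1 huv
    simp_all
  · rw [hstar] at h ⊢
    exact fun a ha => h a (List.mem_append_left w ha)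

lemma IsSD.decode {M : Type w} [Monoid M] {f : A → M} {c : A} {B : Finset A} (hc : c ∉ B)
    (hB : ∀ m, IsSD (wordsWithValue f B m)) {K : Language M} (hK : IsSD K) :
    IsSD (decode f c B K) := by
  induction hK with
  | empty => rw [decode_zero]; exact .empty
  | letter m =>
    refine ((hB m).concat (.letter c)).of_mem_iff fun w => ?_
    constructor
    · rintro ⟨l, rfl, h⟩
      generalize hm : [m] = l at h
      cases h with
      | nil => simp at hm
      | cons hB h =>
        obtain ⟨rfl, rfl⟩ := List.cons.inj hm
        rw [h.eq_nil_of_nil]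
        exact Language.append_mem_mul ⟨hB, rfl⟩ rfl
    · intro h
      obtain ⟨u, ⟨hu, rfl⟩, v, rfl, rfl⟩ := Language.mem_mul.1 h
      exact ⟨_, rfl, .cons hu .nil⟩
  | union _ _ h h' => rw [decode_add]; exact h.union h'
  | concat _ _ h h' => rw [decode_mul]; exact h.concat h'
  | star _ hp hd h =>
    rw [decode_kstar]
    obtain ⟨d, hd⟩ := hd
    exact h.star (hp.decode hc) ⟨d + 1, hd.decode hc hp⟩

/-- The second summand cuts at the first and last `c`; the middle value is read in the local
divisor. -/
lemma wordsWithValue_insert [DecidableEq A] {M : Type w} [Monoid M] (f : A → M) {c : A}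
    {B : Finset A} (p : M) :
    wordsWithValue f (insert c B) p = wordsWithValue f B p +
      ⨆ i : {i : M × LocalDivisor (f c) × M // i.1 * i.2.1.1 * i.2.2 = p},
        wordsWithValue f B i.1.1 *
          ({[c]} * decode f c B (wordsOfValue (LocalDivisor.sandwich (f c)) i.1.2.1) *
            wordsWithValue f B i.1.2.2) := by
  ext w
  rw [Language.mem_add, Language.mem_iSup]
  constructor
  · rintro ⟨hw, rfl⟩
    by_cases hcw : c ∈ w
    · right
      obtain ⟨u, r, rfl, hu⟩ := List.eq_append_cons_of_mem hcw
      obtain ⟨x, y, l, rfl, hx, hy⟩ := exists_isCoded_append (f := f) (c := c) (B := B) r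
        fun a ha => hw a (by simp [ha])
      refine ⟨⟨((u.map f).prod, (l.map (LocalDivisor.sandwich (f c))).prod, (y.map f).prod), ?_⟩, ?_⟩
      · simp [← hx.mul_prod, mul_assoc]
      · refine Language.append_mem_mul ⟨fun a ha => ?_, rfl⟩ (Language.append_mem_mul
          (a := [c] ++ x) (Language.append_mem_mul rfl ⟨l, rfl, hx⟩) ⟨hy, rfl⟩)
        rcases Finset.mem_insert.1 (hw a (by simp [ha])) with rfl | h
        · exact absurd ha hu
        · exact h
    · refine Or.inl ⟨fun a ha => ?_, rfl⟩
      rcases Finset.mem_insert.1 (hw a ha) with rfl | h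
      · exact absurd ha hcw
      · exact h
  · rintro (⟨hw, rfl⟩ | ⟨⟨⟨m, n, m'⟩, hp⟩, h⟩)
    · exact ⟨fun a ha => Finset.mem_insert_of_mem (hw a ha), rfl⟩
    · obtain ⟨u, ⟨hu, rfl⟩, _, h₁, rfl⟩ := Language.mem_mul.1 h
      obtain ⟨_, h₂, y, ⟨hy, rfl⟩, rfl⟩ := Language.mem_mul.1 h₁
      obtain ⟨_, rfl, x, ⟨l, rfl, hx⟩, rfl⟩ := Language.mem_mul.1 h₂
      refine ⟨?_, ?_⟩
      · have hxB := hx.forall_mem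
        simp only [List.mem_append, List.mem_singleton, Finset.mem_insert]
        rintro a (ha | (rfl | ha) | ha)
        · exact Or.inr (hu a ha)
        · exact Or.inl rfl
        · exact hxB a ha
        · exact Or.inr (hy a ha)
      · simp only [← hp, ← hx.mul_prod]
        simp [mul_assoc]

lemma isSD_wordsWithValue_of_localDivisor {M : Type w} [Monoid M] [Finite M] (f : A → M)
    (ih : ∀ c : M, c ≠ 1 → ∀ n : LocalDivisor c,
      IsSD (wordsOfValue (LocalDivisor.sandwich c) n))
    (C : Finset A) (p : M) : IsSD (wordsWithValue f C p) := by
  classical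
  induction C using Finset.strongInduction generalizing p with
  | H C ihC =>
    by_cases hC : ∃ c ∈ C, f c ≠ 1
    · obtain ⟨c, hcC, hc⟩ := hC
      have hB := ihC _ (Finset.erase_ssubset hcC)
      rw [← Finset.insert_erase hcC, wordsWithValue_insert]
      exact (hB p).union <| IsSD.iSup fun i => (hB _).concat <|
        ((IsSD.letter c).concat (IsSD.decode (Finset.notMem_erase c C) hB (ih _ hc _))).concat (hB _)
    -- With all letters of value 1, every word has value 1.
    · push Not at hC
      have h1 : ∀ w : List A, (∀ a ∈ w, a ∈ C) → (w.map f).prod = 1 := fun w hw =>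
        List.prod_eq_one (by simpa using fun a ha => hC a (hw a ha))
      by_cases hp : p = 1
      · subst hp
        refine (isSD_wordsOver C).of_mem_iff fun w => ?_
        exact ⟨fun h => h.1, fun h => ⟨h, h1 w h⟩⟩
      · refine IsSD.empty.of_mem_iff fun w => ?_
        exact iff_of_false (fun h => hp (h.2.symm.trans (h1 w h.1))) (Language.notMem_zero w)

lemma isSD_wordsOfValue_of_wordsWithValue [Finite A] {M : Type w} [Monoid M] {f : A → M} {p : M}
    (h : ∀ C : Finset A, IsSD (wordsWithValue f C p)) :
    IsSD (wordsOfValue f p) := by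
  have := Fintype.ofFinite A
  refine (h Finset.univ).of_mem_iff fun w => ?_
  simp [mem_wordsWithValue, mem_wordsOfValue]

/-- The inductive step uses `M` itself as the new alphabet, so alphabet and monoid share a universe
here; one more unfolding then frees the alphabet. -/
lemma isSD_wordsOfValue_aux {M : Type w} [Monoid M] [Finite M] (hM : IsAperiodicMonoid M)
    {A : Type w} [Finite A] (f : A → M) (p : M) :
    IsSD (wordsOfValue f p) := by
  induction h : Nat.card M using Nat.strong_induction_on generalizing M A with
  | _ n ih =>
    exact isSD_wordsOfValue_of_wordsWithValue fun C => isSD_wordsWithValue_of_localDivisor f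
      (fun c hc q => ih _ (h ▸ LocalDivisor.card_lt hM hc) (LocalDivisor.isAperiodicMonoid hM)
        (LocalDivisor.sandwich c) q rfl) C p

lemma isSD_wordsOfValue {M : Type w} [Monoid M] [Finite M] (hM : IsAperiodicMonoid M)
    [Finite A] (f : A → M) (p : M) : IsSD (wordsOfValue f p) :=
  isSD_wordsOfValue_of_wordsWithValue fun C => isSD_wordsWithValue_of_localDivisor f
    (fun c _ q => isSD_wordsOfValue_aux (LocalDivisor.isAperiodicMonoid hM)
      (LocalDivisor.sandwich c) q) C p

lemma isAperiodicMonoid_withOne {S : Type v} [Semigroup S] (hS : IsAperiodicSemigroup S) :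
    IsAperiodicMonoid (WithOne S) := by
  intro x
  rcases x with _ | x
  · change ∃ n : ℕ, (1 : WithOne S) ^ (n + 1) = 1 ^ n
    exact ⟨0, by simp⟩
  · change ∃ n : ℕ, (x : WithOne S) ^ (n + 1) = (x : WithOne S) ^ n
    obtain ⟨n, hn⟩ := hS x
    -- `semigroupPow x n` has exponent `n + 1`.
    refine ⟨n + 1, ?_⟩
    rw [← semigroupPow_eq_pow, ← semigroupPow_eq_pow]
    have h := fun k => semigroupPow_map (WithOne.coeMulHom (α := S)) x k
    simp only [WithOne.coeMulHom_apply] at h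
    rw [← h, ← h, hn]

lemma IsRecognizedByFiniteAperiodicSemigroup.isSD [Finite A] {L : Language A}
    (hL : IsRecognizedByFiniteAperiodicSemigroup.{u, v} L) : IsSD L := by
  obtain ⟨S, _, _, hS, φ, P, hP⟩ := hL
  have : Finite (WithOne S) := inferInstanceAs (Finite (Option S))
  set f : A → WithOne S := fun a => φ (FreeMonoid.of a)
  have hf : ∀ a w, ((a :: w).map f).prod = φ (FreeMonoid.ofList (a :: w)) := by
    intro a w
    induction w generalizing a with
    | nil => simp [f]
    | cons b w ih =>
      rw [List.map_cons, List.prod_cons, ih, ← WithOne.coe_mul, ← map_mul]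
      rfl
  -- In `WithOne S` the empty word takes the new unit as value, whatever `φ` does to it, so no
  -- nonempty word shares its value.
  let Q : Set (WithOne S) := {x | ∃ w ∈ L, (w.map f).prod = x}
  refine (IsSD.iSup (K := fun q : Q => wordsOfValue f q.1)
    fun q => isSD_wordsOfValue (isAperiodicMonoid_withOne hS) f q.1).of_mem_iff fun w => ?_
  rw [Language.mem_iSup]
  constructor
  · exact fun hw => ⟨⟨_, w, hw, rfl⟩, rfl⟩
  · rintro ⟨⟨_, z, hz, rfl⟩, h⟩
    change (w.map f).prod = (z.map f).prod at h
    rcases w with _ | ⟨a, w⟩ <;> rcases z with _ | ⟨b, z⟩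
    · exact hz
    · rw [hf] at h
      exact absurd h WithOne.one_ne_coe
    · rw [hf] at h
      exact absurd h WithOne.coe_ne_one
    · rw [hf, hf, WithOne.coe_inj] at h
      rwa [hP, h, ← hP]

end SD

theorem mainTheorem3 {A : Type u} [Finite A] (L : Language A) :
    List.TFAE
      [IsRecognizedByFiniteAperiodicSemigroup.{u, v} L,
       IsSD L,
       IsStarFree L] := by
  tfae_have 1 → 2 := fun h => h.isSD
  tfae_have 2 → 3 := fun h => h.isStarFree
  tfae_have 3 → 1 := fun h =>
    h.isRecognizedByFiniteAperiodicMonoid.isRecognizedByFiniteAperiodicSemigroup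
  tfae_finish
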